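/- Let $\alpha>1$ be a real algebraic number and $\xi>0$ a real number. Call $\alpha$ a Pisot--Vijayaraghavan number (PV-number) if $\alpha>1$ is an algebraic integer all of whose conjugates over $\mathbb{Q}$ other than $\alpha$ itself have absolute value strictly less than $1$. Then the sequence of fractional parts $\{\xi\alpha^n\}$, $n\in\mathbb{N}$, has only finitely many limit points in $\mathbb{R}$ (that is, only finitely many real numbers are limits of subsequences of it) if and only if $\alpha$ is a PV-number and $\xi\in\mathbb{Q}(\alpha)$. -/

import Mathlib

open Filter
open scoped IntermediateField

/-- A real number `α` is a Pisot–Vijayaraghavan number: an algebraic integer `α > 1` all of whose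
complex conjugates over `ℚ`, other than `α` itself, lie strictly inside the unit disc. -/
def IsPVNumber (α : ℝ) : Prop :=
  1 < α ∧ IsIntegral ℤ α ∧ ∀ z : ℂ, IsConjRoot ℚ (α : ℂ) z → z ≠ (α : ℂ) → ‖z‖ < 1

/-- The limit points of a sequence of real numbers: the points each of whose neighbourhoods
contains infinitely many terms (equivalently, the limits of subsequences). A value taken for
infinitely many indices counts as a limit point. -/
def seqLimitPoints (u : ℕ → ℝ) : Set ℝ :=
  {x | MapClusterPt x atTop u}

open Polynomial Topology

/-! Let `P` be the minimal polynomial of `α`. Polynomials act on sequences through the shift, and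
`P` kills `ξ α ^ n`.

Finiteness forces PV: finitely many limit points give `ξ α ^ n = m n + l n + o(1)` with `m`
integer-valued and `l` finite-valued. An integral multiple of `P` sends `m + l` to a null sequence
with values in an integer translate of a finite set, hence eventually zero
(`eventually_aeval_seqShift_eq_zero`). Modulo `ℚ`, the tail of `l` is then finite-valued and killed
by `P`, so it vanishes (`eq_zero_of_finite_range_of_minpoly`): `m + l` becomes a rational recurrence
`y` with bounded denominators. Applying `P / (X - α)` to `y` gives `t n = t 0 * α ^ n` in `ℚ(α)`.
Comparing with `ξ α ^ n` under each embedding yields `t 0 = ξ P'(α)` and pushes the other conjugates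
inside the unit disc; the `ℤ`-span of `t` makes `α` integral
(`isPVNumber_and_mem_of_rational_approx`).

Conversely, if `N ξ` is an algebraic integer, the trace of `N ξ α ^ n` is an integer and differs
from `N ξ α ^ n` by powers of small conjugates. Limit points therefore lie in `(1/N) ℤ ∩ [0, 1]`. -/

/-- The shift `u ↦ (n ↦ u (n + 1))` on sequences. -/
abbrev seqShift (R M : Type*) [CommRing R] [AddCommGroup M] [Module R M] :
    Module.End R (ℕ → M) :=
  LinearMap.funLeft R M (· + 1)

/-! ### Linear recurrences as polynomials in the shift -/

section Shift

variable {R M : Type*} [CommRing R] [AddCommGroup M] [Module R M]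

theorem seqShift_pow_apply (k : ℕ) (u : ℕ → M) (n : ℕ) :
    ((seqShift R M) ^ k) u n = u (n + k) := by
  induction k generalizing n with
  | zero => simp
  | succ k ih =>
    rw [pow_succ', Module.End.mul_apply, LinearMap.funLeft_apply, ih]
    congr 1; ring

theorem aeval_seqShift_apply (p : R[X]) (u : ℕ → M) (n : ℕ) :
    aeval (seqShift R M) p u n = p.sum fun i a => a • u (n + i) := by
  rw [aeval_eq_sum_range, sum_over_range _ (by simp)]
  simp [Finset.sum_apply, seqShift_pow_apply]

theorem aeval_seqShift_apply_range (p : R[X]) (u : ℕ → M) (n : ℕ) :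
    aeval (seqShift R M) p u n = ∑ i ∈ Finset.range (p.natDegree + 1), p.coeff i • u (n + i) := by
  rw [aeval_seqShift_apply, sum_over_range _ (by simp)]

/-- A sequence satisfying a monic recurrence is determined by its initial values. -/
theorem eq_zero_of_aeval_seqShift {p : R[X]} (hp : p.Monic) {u : ℕ → M}
    (hu : aeval (seqShift R M) p u = 0) (h0 : ∀ i < p.natDegree, u i = 0) : u = 0 := by
  funext n
  induction n using Nat.strong_induction_on with
  | _ n ih =>
    by_cases hn : n < p.natDegree
    · exact h0 n hn
    · obtain ⟨m, rfl⟩ := Nat.exists_eq_add_of_le' (not_lt.mp hn)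
      have h := congrFun hu m
      rw [aeval_seqShift_apply_range, Finset.sum_range_succ, hp.coeff_natDegree,
        Finset.sum_eq_zero, zero_add, one_smul] at h
      · exact h
      · intro i hi
        rw [Finset.mem_range] at hi
        rw [ih (m + i) (by omega)]
        simp

/-- A finite-valued sequence satisfying a monic recurrence is eventually periodic. -/
theorem exists_seqShift_pow_eq {p : R[X]} (hp : p.Monic) {u : ℕ → M}
    (hu : aeval (seqShift R M) p u = 0) (hfin : (Set.range u).Finite) :
    ∃ a b : ℕ, a < b ∧ aeval (seqShift R M) ((X : R[X]) ^ b - X ^ a) u = 0 := by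
  have : Finite (Set.range u) := hfin
  -- Pigeonhole on windows of length `p.natDegree`: two of them coincide, and a window determines
  -- all later terms.
  obtain ⟨a, b, hab, h⟩ := Finite.exists_ne_map_eq_of_infinite
    (fun k : ℕ => fun i : Fin p.natDegree => (⟨u (k + i), k + i, rfl⟩ : Set.range u))
  wlog hlt : a < b generalizing a b
  · exact this b a hab.symm h.symm (lt_of_le_of_ne (not_lt.mp hlt) hab.symm)
  refine ⟨a, b, hlt, eq_zero_of_aeval_seqShift hp ?_ ?_⟩
  · rw [← Module.End.mul_apply, ← map_mul, mul_comm, map_mul, Module.End.mul_apply, hu, map_zero]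
  · intro i hi
    have h' := congrArg Subtype.val (congrFun h ⟨i, hi⟩)
    simp only at h'
    rw [map_sub, LinearMap.sub_apply, map_pow, map_pow, aeval_X, Pi.sub_apply,
      seqShift_pow_apply, seqShift_pow_apply, add_comm i, add_comm i, h', sub_self]

end Shift

theorem eq_zero_of_isCoprime_aeval {R V : Type*} [CommRing R] [AddCommGroup V] [Module R V]
    (T : Module.End R V) {p q : R[X]} (h : IsCoprime p q) {v : V}
    (hp : aeval T p v = 0) (hq : aeval T q v = 0) : v = 0 := by
  obtain ⟨a, b, hab⟩ := h
  have := congrArg (fun r => aeval T r v) hab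
  simpa [hp, hq] using this.symm

/-- A finite-valued sequence over a rational vector space that is killed by the minimal polynomial
of a number `α > 1` vanishes. -/
theorem eq_zero_of_finite_range_of_minpoly {M : Type*} [AddCommGroup M] [Module ℚ M] {α : ℝ}
    (hα : IsIntegral ℚ α) (hα1 : 1 < α) {u : ℕ → M}
    (hu : aeval (seqShift ℚ M) (minpoly ℚ α) u = 0) (hfin : (Set.range u).Finite) : u = 0 := by
  obtain ⟨a, b, hab, h⟩ := exists_seqShift_pow_eq (minpoly.monic hα) hu hfin
  refine eq_zero_of_isCoprime_aeval _ ?_ hu h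
  -- Divisibility would make `α` a root of `X ^ b - X ^ a`, impossible for `α > 1`.
  refine ((minpoly.irreducible hα).coprime_iff_not_dvd).mpr fun hd => ?_
  have h0 : aeval α ((X : ℚ[X]) ^ b - X ^ a) = 0 :=
    (minpoly.dvd_iff).mp hd
  simp only [map_sub, map_pow, aeval_X] at h0
  have := pow_lt_pow_right₀ hα1 hab
  linarith

/-! ### Limit points and null sequences -/

section Cluster

/-- A sequence in a compact set with finitely many limit points is asymptotic to a sequence of
limit points. -/
theorem exists_tendsto_sub_of_finite_seqLimitPoints {u : ℕ → ℝ} {s : Set ℝ} (hs : IsCompact s)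
    (hu : ∀ n, u n ∈ s) (hfin : (seqLimitPoints u).Finite) :
    ∃ l : ℕ → ℝ, (∀ n, l n ∈ seqLimitPoints u) ∧ Tendsto (fun n => u n - l n) atTop (𝓝 0) := by
  have hne : (seqLimitPoints u).Nonempty := by
    obtain ⟨x, -, hx⟩ := hs.exists_mapClusterPt_of_frequently (l := atTop) (f := u)
      (Frequently.of_forall hu)
    exact ⟨x, hx⟩
  choose l hl hd using fun n => hfin.isCompact.exists_infDist_eq_dist hne (u n)
  refine ⟨l, hl, ?_⟩
  rw [Metric.tendsto_atTop']
  by_contra! hcon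
  obtain ⟨ε, hε, hcon⟩ := hcon
  have hcl : IsClosed {x : ℝ | ε ≤ Metric.infDist x (seqLimitPoints u)} :=
    isClosed_le continuous_const (Metric.continuous_infDist_pt _)
  -- Terms staying `ε` away from the limit points would, by compactness, themselves accumulate at
  -- one `ε` away.
  have hfr : ∃ᶠ n in atTop, u n ∈ s ∩ {x : ℝ | ε ≤ Metric.infDist x (seqLimitPoints u)} := by
    rw [frequently_atTop']
    intro N
    obtain ⟨n, hn, h⟩ := hcon N
    refine ⟨n, hn, hu n, ?_⟩
    rw [Set.mem_ofPred_eq, hd, Real.dist_eq]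
    simpa [Real.dist_eq] using h
  obtain ⟨x, hx, hxc⟩ := (hs.inter_right hcl).exists_mapClusterPt_of_frequently hfr
  have h1 : ε ≤ Metric.infDist x (seqLimitPoints u) := hx.2
  rw [Metric.infDist_zero_of_mem (show x ∈ seqLimitPoints u from hxc)] at h1
  linarith

/-- A null sequence each of whose terms is an integer plus an element of a fixed finite set is
eventually zero. -/
theorem eventually_eq_zero_of_int_add_finite {v : ℕ → ℝ} {F : Set ℝ} (hF : F.Finite)
    (hv : ∀ n, ∃ k : ℤ, v n - k ∈ F) (hlim : Tendsto v atTop (𝓝 0)) :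
    ∀ᶠ n in atTop, v n = 0 := by
  obtain ⟨B, hB⟩ := hF.isBounded.exists_norm_le
  -- Once `|v n| < 1`, the integer part is at most `B + 1` in absolute value, so `v n` lies in this
  -- finite set; its nonzero elements stay away from `0`.
  have hT : ((fun q : ℤ × ℝ => (q.1 : ℝ) + q.2) ''
      (Set.Icc (-⌈B + 1⌉) ⌈B + 1⌉ ×ˢ F)).Finite :=
    ((Set.finite_Icc _ _).prod hF).image _
  have h1 := hlim.eventually ((hT.sdiff (t := {0})).isClosed.isOpen_compl.mem_nhds (by simp))
  have h2 : ∀ᶠ n in atTop, |v n| < 1 := by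
    have := hlim.abs
    rw [abs_zero] at this
    exact this.eventually (gt_mem_nhds one_pos)
  filter_upwards [h1, h2] with n hn1 hn2
  by_contra hne
  refine hn1 ⟨?_, hne⟩
  obtain ⟨k, hk⟩ := hv n
  have hb := hB _ hk
  rw [Real.norm_eq_abs, abs_le] at hb
  rw [abs_lt] at hn2
  have hc := Int.le_ceil (B + 1)
  refine ⟨(k, v n - k), ⟨⟨?_, ?_⟩, hk⟩, by simp⟩
  · have : (-⌈B + 1⌉ : ℝ) ≤ k := by linarith
    exact_mod_cast this
  · have : (k : ℝ) ≤ ⌈B + 1⌉ := by linarith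
    exact_mod_cast this

theorem finite_range_aeval_seqShift {R M : Type*} [CommRing R] [AddCommGroup M] [Module R M]
    (p : R[X]) {u : ℕ → M} (hu : (Set.range u).Finite) :
    (Set.range (aeval (seqShift R M) p u)).Finite := by
  have : Finite (Set.range u) := hu
  refine (Set.finite_range (fun s : Fin (p.natDegree + 1) → Set.range u =>
    ∑ i : Fin (p.natDegree + 1), p.coeff i • (s i : M))).subset ?_
  rintro _ ⟨n, rfl⟩
  refine ⟨fun i => ⟨u (n + i), n + i, rfl⟩, ?_⟩
  rw [aeval_seqShift_apply_range, Finset.sum_range]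

theorem tendsto_aeval_seqShift_zero {R M : Type*} [CommRing R] [NormedRing M] [Algebra R M]
    (p : R[X]) {u : ℕ → M} (hu : Tendsto u atTop (𝓝 0)) :
    Tendsto (aeval (seqShift R M) p u) atTop (𝓝 0) := by
  have : aeval (seqShift R M) p u = fun n =>
      ∑ i ∈ Finset.range (p.natDegree + 1), algebraMap R M (p.coeff i) * u (n + i) := by
    funext n
    rw [aeval_seqShift_apply_range]
    simp only [Algebra.smul_def]
  rw [this]
  have h := tendsto_finsetSum (Finset.range (p.natDegree + 1)) fun i _ =>
    ((tendsto_add_atTop_iff_nat i).mpr hu).const_mul (algebraMap R M (p.coeff i))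
  simpa using h

end Cluster

/-! ### Embeddings of `ℚ(α)` and rational approximations -/

section Core

theorem map_aeval_seqShift_apply {K E : Type*} [Field K] [Field E] (φ : K →+* E) (p : K[X])
    (u : ℕ → K) (n : ℕ) :
    φ (aeval (seqShift K K) p u n) = aeval (seqShift E E) (p.map φ) (fun k => φ (u k)) n := by
  simp [aeval_seqShift_apply_range]

/-- Allows one recurrence to be read over `ℤ`, `ℚ` or `ℝ`. The degree may drop under the map, so the
sum is taken over the original range. -/
theorem aeval_seqShift_map_algebraMap {R S M : Type*} [CommRing R] [CommRing S] [Algebra R S]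
    [AddCommGroup M] [Module R M] [Module S M] [IsScalarTower R S M] (p : R[X]) (u : ℕ → M) :
    aeval (seqShift S M) (p.map (algebraMap R S)) u = aeval (seqShift R M) p u := by
  funext n
  rw [aeval_seqShift_apply, aeval_seqShift_apply_range,
    sum_over_range' _ (by simp) (p.natDegree + 1) (Nat.lt_succ_of_le natDegree_map_le)]
  simp

/-- A geometric progression is an eigenvector of the shift. -/
theorem aeval_seqShift_geom {E : Type*} [Field E] (p : E[X]) (c x : E) (n : ℕ) :
    aeval (seqShift E E) p (fun k => c * x ^ k) n = c * p.eval x * x ^ n := by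
  rw [aeval_seqShift_apply_range, eval_eq_sum_range, Finset.mul_sum, Finset.sum_mul]
  refine Finset.sum_congr rfl fun i _ => ?_
  rw [smul_eq_mul, pow_add]
  ring

/-- If `y` is killed by the minimal polynomial of `g`, applying the cofactor of `X - g` turns `y`
into a geometric progression of ratio `g`. -/
theorem aeval_seqShift_minpolyDiv {F K : Type*} [Field F] [Field K] [Algebra F K] (g : K)
    (y : ℕ → F) (hy : aeval (seqShift F F) (minpoly F g) y = 0) (n : ℕ) :
    aeval (seqShift K K) (minpolyDiv F g) (fun k => algebraMap F K (y k)) n =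
      aeval (seqShift K K) (minpolyDiv F g) (fun k => algebraMap F K (y k)) 0 * g ^ n := by
  set t := aeval (seqShift K K) (minpolyDiv F g) (fun k => algebraMap F K (y k)) with ht
  have h0 : aeval (seqShift K K) (X - C g) t = 0 := by
    rw [ht, ← Module.End.mul_apply, ← map_mul, mul_comm, minpolyDiv_spec]
    funext k
    rw [← map_aeval_seqShift_apply, hy]
    simp
  induction n with
  | zero => simp
  | succ n ih =>
    have h1 := congrFun h0 n
    simp only [map_sub, aeval_X, aeval_C, LinearMap.sub_apply, Pi.sub_apply, Pi.zero_apply,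
      LinearMap.funLeft_apply, Module.algebraMap_end_apply, Pi.smul_apply, smul_eq_mul] at h1
    rw [sub_eq_zero.mp h1, ih, pow_succ]
    ring

theorem eq_zero_of_tendsto_mul_pow {c z : ℂ} (hz : 1 ≤ ‖z‖)
    (h : Tendsto (fun n : ℕ => c * z ^ n) atTop (𝓝 0)) : c = 0 := by
  have h1 : ‖c‖ ≤ 0 := by
    refine ge_of_tendsto' (tendsto_zero_iff_norm_tendsto_zero.mp h) fun n => ?_
    rw [norm_mul, norm_pow]
    exact le_mul_of_one_le_right (norm_nonneg _) (one_le_pow₀ hz)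
  simpa using h1

/-- The inclusion of a subfield of `ℝ` into `ℂ`. -/
noncomputable def realSubfieldEmbedding (K : IntermediateField ℚ ℝ) : K →ₐ[ℚ] ℂ :=
  (Complex.ofRealAm.restrictScalars ℚ).comp K.val

theorem realSubfieldEmbedding_apply (K : IntermediateField ℚ ℝ) (x : K) :
    realSubfieldEmbedding K x = ((x : ℝ) : ℂ) := rfl

theorem minpoly_ofReal (α : ℝ) : minpoly ℚ (α : ℂ) = minpoly ℚ α :=
  minpoly.algHom_eq (Complex.ofRealAm.restrictScalars ℚ) Complex.ofReal_injective α

theorem minpoly_adjoinSimple_gen (α : ℝ) :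
    minpoly ℚ (IntermediateField.AdjoinSimple.gen ℚ α) = minpoly ℚ α := by
  have h := minpoly.algHom_eq (realSubfieldEmbedding ℚ⟮α⟯)
    (realSubfieldEmbedding ℚ⟮α⟯).toRingHom.injective (IntermediateField.AdjoinSimple.gen ℚ α)
  rw [← h, realSubfieldEmbedding_apply, IntermediateField.AdjoinSimple.coe_gen, minpoly_ofReal]

/-- Together with `isConjRoot_embedding`, turns conditions on conjugates into conditions on
embeddings. -/
theorem exists_embedding_of_isConjRoot {α : ℝ} (hα : IsIntegral ℚ α) {z : ℂ}
    (hz : IsConjRoot ℚ (α : ℂ) z) :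
    ∃ φ : ℚ⟮α⟯ →ₐ[ℚ] ℂ, φ (IntermediateField.AdjoinSimple.gen ℚ α) = z := by
  have h : aeval z (minpoly ℚ (IntermediateField.adjoin.powerBasis hα).gen) = 0 := by
    rw [IntermediateField.adjoin.powerBasis_gen, minpoly_adjoinSimple_gen, ← minpoly_ofReal,
      isConjRoot_def.mp hz, minpoly.aeval]
  refine ⟨(IntermediateField.adjoin.powerBasis hα).lift z h, ?_⟩
  have := (IntermediateField.adjoin.powerBasis hα).lift_gen z h
  rwa [IntermediateField.adjoin.powerBasis_gen] at this

theorem isConjRoot_embedding {α : ℝ} (φ : ℚ⟮α⟯ →ₐ[ℚ] ℂ) :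
    IsConjRoot ℚ (α : ℂ) (φ (IntermediateField.AdjoinSimple.gen ℚ α)) := by
  rw [isConjRoot_def, minpoly_ofReal, minpoly.algHom_eq φ φ.toRingHom.injective,
    minpoly_adjoinSimple_gen]

/-- Applying an embedding `φ` of `ℚ(α)` to the cofactor identity for a rational recurrence `y`
asymptotic to `ξ α ^ n`. -/
theorem tendsto_embedding_sub_geom {α ξ : ℝ} {y : ℕ → ℚ}
    (hy : aeval (seqShift ℚ ℚ) (minpoly ℚ α) y = 0)
    (hlim : Tendsto (fun n => ξ * α ^ n - (y n : ℝ)) atTop (𝓝 0)) (φ : ℚ⟮α⟯ →ₐ[ℚ] ℂ) :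
    Tendsto (fun n : ℕ =>
      φ (aeval (seqShift ℚ⟮α⟯ ℚ⟮α⟯) (minpolyDiv ℚ (IntermediateField.AdjoinSimple.gen ℚ α))
        (fun k => algebraMap ℚ ℚ⟮α⟯ (y k)) 0) * φ (IntermediateField.AdjoinSimple.gen ℚ α) ^ n
      - ξ * eval₂ (φ : ℚ⟮α⟯ →+* ℂ) (α : ℂ)
          (minpolyDiv ℚ (IntermediateField.AdjoinSimple.gen ℚ α)) * (α : ℂ) ^ n)
      atTop (𝓝 0) := by
  set g := IntermediateField.AdjoinSimple.gen ℚ α with hg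
  have hy' : aeval (seqShift ℚ ℚ) (minpoly ℚ g) y = 0 := by
    rwa [hg, minpoly_adjoinSimple_gen]
  have h1 : Tendsto (fun n => (y n : ℂ) - ξ * (α : ℂ) ^ n) atTop (𝓝 0) := by
    have := (Complex.continuous_ofReal.tendsto _).comp hlim.neg
    rw [neg_zero, Complex.ofReal_zero] at this
    refine this.congr fun n => ?_
    simp
  have h2 := tendsto_aeval_seqShift_zero ((minpolyDiv ℚ g).map (φ : ℚ⟮α⟯ →+* ℂ)) h1
  refine h2.congr fun n => ?_
  have h3 : (fun n => (y n : ℂ) - ξ * (α : ℂ) ^ n) =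
      (fun n => (φ : ℚ⟮α⟯ →+* ℂ) (algebraMap ℚ ℚ⟮α⟯ (y n))) - fun n => (ξ : ℂ) * (α : ℂ) ^ n := by
    funext n
    simp
  rw [h3, map_sub, Pi.sub_apply, ← map_aeval_seqShift_apply, aeval_seqShift_geom,
    aeval_seqShift_minpolyDiv g y hy' n, eval_map]
  simp

/-- A rational sequence with bounded denominators which satisfies the recurrence of `α` and is
asymptotic to `ξ α ^ n` forces `α` to be a PV-number and `ξ ∈ ℚ(α)`. -/
theorem isPVNumber_and_mem_of_rational_approx {α ξ : ℝ} (hα : IsIntegral ℚ α) (hα1 : 1 < α)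
    (hξ : ξ ≠ 0) {y : ℕ → ℚ} {N : ℤ} (hN : N ≠ 0) (hyN : ∀ n, ∃ k : ℤ, N * y n = k)
    (hy : aeval (seqShift ℚ ℚ) (minpoly ℚ α) y = 0)
    (hlim : Tendsto (fun n => ξ * α ^ n - (y n : ℝ)) atTop (𝓝 0)) :
    IsPVNumber α ∧ ξ ∈ ℚ⟮α⟯ := by
  set g := IntermediateField.AdjoinSimple.gen ℚ α with hg
  have hgα : (g : ℝ) = α := IntermediateField.AdjoinSimple.coe_gen ℚ α
  have hgi : IsIntegral ℚ g := (IntermediateField.AdjoinSimple.isIntegral_gen ℚ α).mpr hα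
  have hy' : aeval (seqShift ℚ ℚ) (minpoly ℚ g) y = 0 := by
    rwa [hg, minpoly_adjoinSimple_gen]
  set t := aeval (seqShift ℚ⟮α⟯ ℚ⟮α⟯) (minpolyDiv ℚ g) (fun k => algebraMap ℚ ℚ⟮α⟯ (y k)) with ht
  have htn : ∀ n, t n = t 0 * g ^ n := aeval_seqShift_minpolyDiv g y hy'
  have hnorm : 1 ≤ ‖(α : ℂ)‖ := by
    rw [Complex.norm_real, Real.norm_eq_abs]
    exact hα1.le.trans (le_abs_self _)
  set e : ℚ⟮α⟯ := aeval g (derivative (minpoly ℚ g)) with he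
  have he0 : e ≠ 0 :=
    ((minpoly.irreducible hgi).separable).aeval_derivative_ne_zero (minpoly.aeval _ _)
  let ι := realSubfieldEmbedding ℚ⟮α⟯
  have hιg : ι g = (α : ℂ) := by rw [realSubfieldEmbedding_apply, hgα]
  classical
  -- The conjugated cofactor is `P / (X - φ g)`. It vanishes at the root `α` of `P` unless `φ g =
  -- α`, where it takes the value of `P'`.
  have heval : ∀ φ : ℚ⟮α⟯ →ₐ[ℚ] ℂ, eval₂ (φ : ℚ⟮α⟯ →+* ℂ) (α : ℂ) (minpolyDiv ℚ g) =
      if φ g = (α : ℂ) then φ e else 0 := by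
    intro φ
    have := eval₂_minpolyDiv_self (R := ℚ) g φ ι
    rw [hιg] at this
    exact this
  have hmain := fun φ => tendsto_embedding_sub_geom hy hlim φ
  -- Under the inclusion both terms are multiples of `α ^ n`, which does not tend to zero, so their
  -- coefficients agree.
  have hw : (t 0 : ℝ) = ξ * e := by
    have h := hmain ι
    rw [← hg, heval ι, if_pos hιg, hιg] at h
    simp_rw [← sub_mul] at h
    have h2 := sub_eq_zero.mp (eq_zero_of_tendsto_mul_pow hnorm h)
    rw [realSubfieldEmbedding_apply, realSubfieldEmbedding_apply] at h2
    exact_mod_cast h2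
  have he0' : (e : ℝ) ≠ 0 := by exact_mod_cast he0
  have ht0 : t 0 ≠ 0 := by
    intro h
    rw [h] at hw
    exact mul_ne_zero hξ he0' (by simpa using hw.symm)
  refine ⟨⟨hα1, ?_, ?_⟩, ?_⟩
  · have hgint : IsIntegral ℤ g := by
      -- The span `V` of the `t n` is stable under `g` because `t (n + 1) = g * t n`. Bounded
      -- denominators place it inside the finitely generated `W`.
      let W : Submodule ℤ ℚ⟮α⟯ := Submodule.span ℤ
        (Set.range fun i : Fin ((minpolyDiv ℚ g).natDegree + 1) =>
          (minpolyDiv ℚ g).coeff i * algebraMap ℚ ℚ⟮α⟯ (N : ℚ)⁻¹)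
      have hWfg : W.FG := Submodule.fg_span (Set.finite_range _)
      let V : Submodule ℤ ℚ⟮α⟯ := Submodule.span ℤ (Set.range t)
      have hVW : V ≤ W := by
        refine Submodule.span_le.mpr ?_
        rintro _ ⟨n, rfl⟩
        rw [ht, aeval_seqShift_apply_range, Finset.sum_range]
        refine Submodule.sum_mem _ fun i _ => ?_
        obtain ⟨k, hk⟩ := hyN (n + i)
        have hk' : y (n + i) = (N : ℚ)⁻¹ * k := by
          rw [← hk, inv_mul_cancel_left₀ (by exact_mod_cast hN)]
        have : (minpolyDiv ℚ g).coeff i • algebraMap ℚ ℚ⟮α⟯ (y (n + i)) =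
            k • ((minpolyDiv ℚ g).coeff i * algebraMap ℚ ℚ⟮α⟯ (N : ℚ)⁻¹) := by
          rw [hk', map_mul, smul_eq_mul, zsmul_eq_mul, map_intCast]
          ring
        rw [this]
        exact Submodule.smul_mem _ _ (Submodule.subset_span ⟨i, rfl⟩)
      have : IsNoetherian ℤ W := isNoetherian_of_fg_of_noetherian W hWfg
      have hVfg : V.FG := Submodule.FG.of_le_of_isNoetherian hVW
      refine isIntegral_of_smul_mem_submodule V ?_ hVfg g ?_
      · intro h
        have : t 0 ∈ V := Submodule.subset_span ⟨0, rfl⟩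
        rw [h] at this
        exact ht0 (by simpa using this)
      · intro x hx
        induction hx using Submodule.span_induction with
        | mem x hx =>
          obtain ⟨n, rfl⟩ := hx
          refine Submodule.subset_span ⟨n + 1, ?_⟩
          rw [htn, htn n, pow_succ, smul_eq_mul]
          ring
        | zero => simp
        | add x y _ _ hx hy => rw [smul_add]; exact V.add_mem hx hy
        | smul a x _ hx => rw [smul_comm]; exact V.smul_mem a hx
    have := hgint.map (algebraMap ℚ⟮α⟯ ℝ).toIntAlgHom
    exact hgα ▸ this
  · intro z hz hzα
    obtain ⟨φ, rfl⟩ := exists_embedding_of_isConjRoot hα hz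
    -- The `α ^ n` term disappears for this embedding, leaving a null multiple of the powers of the
    -- conjugate.
    by_contra! hge
    have h := hmain φ
    rw [← hg] at h hge hzα
    rw [heval φ, if_neg hzα] at h
    simp only [mul_zero, zero_mul, sub_zero] at h
    exact ht0 ((map_eq_zero φ).mp (eq_zero_of_tendsto_mul_pow hge h))
  · have : ξ = ((t 0 / e : ℚ⟮α⟯) : ℝ) := by
      push_cast
      rw [hw, mul_div_cancel_right₀ _ he0']
    rw [this]
    exact SetLike.coe_mem _

end Core

/-! ### PV-numbers give finitely many limit points -/

/-- If `α` is PV and `ξ ∈ ℚ(α)`, then `ξ α ^ n` approaches a fixed lattice `(1/N) ℤ`. -/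
theorem exists_tendsto_int_of_isPVNumber {α ξ : ℝ} (hα : IsPVNumber α) (hξ : ξ ∈ ℚ⟮α⟯) :
    ∃ N : ℤ, N ≠ 0 ∧ ∃ k : ℕ → ℤ,
      Tendsto (fun n => N * (ξ * α ^ n) - (k n : ℝ)) atTop (𝓝 0) := by
  classical
  obtain ⟨hα1, hint, hconj⟩ := hα
  have hαQ : IsIntegral ℚ α := hint.tower_top
  have : FiniteDimensional ℚ ℚ⟮α⟯ := IntermediateField.adjoin.finiteDimensional hαQ
  have : NumberField ℚ⟮α⟯ := { }
  set g := IntermediateField.AdjoinSimple.gen ℚ α with hg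
  have hgα : (g : ℝ) = α := IntermediateField.AdjoinSimple.coe_gen ℚ α
  have hgint : IsIntegral ℤ g := by
    refine (isIntegral_algHom_iff (algebraMap ℚ⟮α⟯ ℝ).toIntAlgHom
      (algebraMap ℚ⟮α⟯ ℝ).injective).mp ?_
    change IsIntegral ℤ (g : ℝ)
    rwa [hgα]
  let x : ℚ⟮α⟯ := ⟨ξ, hξ⟩
  have hxalg : IsAlgebraic ℤ x :=
    (IsFractionRing.isAlgebraic_iff ℤ ℚ ℚ⟮α⟯).mpr (Algebra.IsAlgebraic.isAlgebraic x)
  obtain ⟨N, hN, hNx⟩ := hxalg.exists_integral_multiple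
  have htr : ∀ n : ℕ, ∃ k : ℤ, (k : ℚ) = Algebra.trace ℚ ℚ⟮α⟯ ((N • x) * g ^ n) := fun n =>
    IsIntegrallyClosed.isIntegral_iff.mp (Algebra.isIntegral_trace (hNx.mul (hgint.pow n)))
  choose k hk using htr
  refine ⟨N, hN, k, ?_⟩
  let ι := realSubfieldEmbedding ℚ⟮α⟯
  have hιg : ι g = (α : ℂ) := by rw [realSubfieldEmbedding_apply, hgα]
  have hsum : ∀ n, ((k n : ℝ) : ℂ) = ∑ φ : ℚ⟮α⟯ →ₐ[ℚ] ℂ, φ (N • x) * φ g ^ n := by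
    intro n
    have := trace_eq_sum_embeddings (K := ℚ) (L := ℚ⟮α⟯) ℂ (x := (N • x) * g ^ n)
    rw [← hk] at this
    simpa using this
  -- An embedding is determined by the image of `g`, so any `φ ≠ ι` sends `g` to a conjugate other
  -- than `α`.
  have hinj : ∀ φ : ℚ⟮α⟯ →ₐ[ℚ] ℂ, φ ≠ ι → ‖φ g‖ < 1 := by
    intro φ hφ
    refine hconj _ (isConjRoot_embedding φ) fun h => hφ ?_
    refine (IntermediateField.adjoin.powerBasis hαQ).algHom_ext ?_
    rw [IntermediateField.adjoin.powerBasis_gen]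
    exact h.trans hιg.symm
  have hlim : Tendsto (fun n : ℕ => ∑ φ ∈ Finset.univ.erase ι, φ (N • x) * φ g ^ n)
      atTop (𝓝 0) := by
    have := tendsto_finsetSum (Finset.univ.erase ι) fun φ hφ =>
      (tendsto_pow_atTop_nhds_zero_of_norm_lt_one
        (hinj φ (Finset.ne_of_mem_erase hφ))).const_mul (φ (N • x))
    simpa using this
  have hre := (Complex.continuous_re.tendsto _).comp hlim.neg
  rw [neg_zero, Complex.zero_re] at hre
  refine hre.congr fun n => ?_
  have h1 := hsum n
  rw [← Finset.add_sum_erase _ _ (Finset.mem_univ ι), hιg] at h1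
  have h2 : ι (N • x) = ((N * ξ : ℝ) : ℂ) := by
    rw [realSubfieldEmbedding_apply]
    simp [x, zsmul_eq_mul]
  rw [h2] at h1
  have h3 : -∑ φ ∈ Finset.univ.erase ι, φ (N • x) * φ g ^ n =
      ((N * (ξ * α ^ n) - k n : ℝ) : ℂ) := by
    rw [Complex.ofReal_sub, h1]
    push_cast
    ring
  rw [Function.comp_apply, h3, Complex.ofReal_re]

/-- A limit point of a sequence that approaches the integers is an integer. -/
theorem exists_int_of_mapClusterPt {u : ℕ → ℝ} {k : ℕ → ℤ} {x : ℝ}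
    (h : Tendsto (fun n => u n - (k n : ℝ)) atTop (𝓝 0)) (hx : MapClusterPt x atTop u) :
    ∃ m : ℤ, (m : ℝ) = x := by
  obtain ⟨f, hf, hfx⟩ := hx.tendsto_subseq
  have h1 : Tendsto (fun n => ((k (f n) : ℤ) : ℝ)) atTop (𝓝 x) := by
    have := hfx.sub (h.comp hf.tendsto_atTop)
    rw [sub_zero] at this
    refine this.congr fun n => ?_
    simp
  exact Int.isClosedEmbedding_coe_real.isClosed_range.mem_of_tendsto h1
    (Eventually.of_forall fun n => ⟨_, rfl⟩)

theorem finite_seqLimitPoints_of_isPVNumber {α ξ : ℝ} (hα : IsPVNumber α) (hξ : ξ ∈ ℚ⟮α⟯) :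
    (seqLimitPoints (fun n : ℕ => Int.fract (ξ * α ^ n))).Finite := by
  obtain ⟨N, hN, k, hk⟩ := exists_tendsto_int_of_isPVNumber hα hξ
  have hN' : (N : ℝ) ≠ 0 := by exact_mod_cast hN
  refine ((Set.finite_Icc (-|N|) |N|).image fun m : ℤ => (m : ℝ) / N).subset fun x hx => ?_
  have hx' : MapClusterPt x atTop (fun n : ℕ => Int.fract (ξ * α ^ n)) := hx
  have hx1 : x ∈ Set.Icc (0 : ℝ) 1 := by
    refine isClosed_Icc.mem_of_mapClusterPt hx' (Eventually.of_forall fun n => ?_)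
    exact ⟨Int.fract_nonneg _, (Int.fract_lt_one _).le⟩
  -- Removing the floor changes `N * (ξ * α ^ n)` by an integer, so `N` times the fractional part
  -- still approaches integers.
  have h1 : Tendsto (fun n => N * Int.fract (ξ * α ^ n) - ((k n - N * ⌊ξ * α ^ n⌋ : ℤ) : ℝ))
      atTop (𝓝 0) := by
    refine hk.congr fun n => ?_
    rw [Int.fract]
    push_cast
    ring
  obtain ⟨m, hm⟩ := exists_int_of_mapClusterPt h1
    (hx'.tendsto_comp ((continuous_const_mul (N : ℝ)).tendsto x))
  refine ⟨m, ?_, ?_⟩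
  · rw [Set.mem_Icc, ← abs_le]
    have : |(m : ℝ)| ≤ |(N : ℝ)| := by
      rw [hm, abs_mul]
      refine mul_le_of_le_one_right (abs_nonneg _) ?_
      rw [abs_of_nonneg hx1.1]
      exact hx1.2
    exact_mod_cast this
  · simp only
    rw [hm, mul_div_cancel_left₀ _ hN']

/-! ### Finitely many limit points force PV -/

theorem aeval_seqShift_comp_linearMap {R M M' : Type*} [CommRing R] [AddCommGroup M] [Module R M]
    [AddCommGroup M'] [Module R M'] (f : M →ₗ[R] M') (p : R[X]) (u : ℕ → M) (n : ℕ) :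
    aeval (seqShift R M') p (fun k => f (u k)) n = f (aeval (seqShift R M) p u n) := by
  simp [aeval_seqShift_apply_range]

theorem aeval_seqShift_translate {R M : Type*} [CommRing R] [AddCommGroup M] [Module R M]
    (p : R[X]) (u : ℕ → M) (k n : ℕ) :
    aeval (seqShift R M) p (fun j => u (j + k)) n = aeval (seqShift R M) p u (n + k) := by
  simp [aeval_seqShift_apply_range, add_right_comm]

theorem aeval_seqShift_minpoly_geom (α ξ : ℝ) :
    aeval (seqShift ℚ ℝ) (minpoly ℚ α) (fun n => ξ * α ^ n) = 0 := by
  funext n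
  rw [← aeval_seqShift_map_algebraMap (S := ℝ), aeval_seqShift_geom, eval_map_algebraMap,
    minpoly.aeval]
  simp

/-- If `m n + l n` is asymptotic to `ξ α ^ n` with `m` integer-valued and `l` finite-valued, then
`m + l` eventually satisfies the linear recurrence of `α`. -/
theorem eventually_aeval_seqShift_eq_zero {α ξ : ℝ} {m : ℕ → ℤ} {l : ℕ → ℝ}
    (hl : (Set.range l).Finite)
    (hlim : Tendsto (fun n => ξ * α ^ n - (m n + l n)) atTop (𝓝 0)) :
    ∀ᶠ n in atTop, aeval (seqShift ℚ ℝ) (minpoly ℚ α) (fun n => (m n : ℝ) + l n) n = 0 := by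
  -- Denominators of `P` are cleared so that the operator maps integer sequences to integer
  -- sequences.
  obtain ⟨b, hb, hA⟩ :=
    IsLocalization.integerNormalization_spec (nonZeroDivisors ℤ) (minpoly ℚ α)
  set A := IsLocalization.integerNormalization (nonZeroDivisors ℤ) (minpoly ℚ α)
  have hb0 : b ≠ 0 := nonZeroDivisors.ne_zero hb
  have hAy : ∀ u : ℕ → ℝ,
      aeval (seqShift ℤ ℝ) A u = b • aeval (seqShift ℚ ℝ) (minpoly ℚ α) u := by
    intro u
    rw [← aeval_seqShift_map_algebraMap (S := ℚ), hA]
    simp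
  have hgeom : aeval (seqShift ℤ ℝ) A (fun n => ξ * α ^ n) = 0 := by
    rw [hAy, aeval_seqShift_minpoly_geom, smul_zero]
  have hv : Tendsto (aeval (seqShift ℤ ℝ) A (fun n => (m n : ℝ) + l n)) atTop (𝓝 0) := by
    have h := (tendsto_aeval_seqShift_zero A hlim).neg
    rw [neg_zero] at h
    refine h.congr fun n => ?_
    have h2 : (fun n => ξ * α ^ n - (m n + l n)) =
      (fun n => ξ * α ^ n) - fun n => (m n : ℝ) + l n := rfl
    rw [h2, map_sub, hgeom, zero_sub, Pi.neg_apply, neg_neg]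
  have h0 := eventually_eq_zero_of_int_add_finite (finite_range_aeval_seqShift A hl)
    (v := aeval (seqShift ℤ ℝ) A (fun n => (m n : ℝ) + l n)) (fun n => ?_) hv
  · filter_upwards [h0] with n hn
    rw [hAy, Pi.smul_apply] at hn
    exact (smul_eq_zero.mp hn).resolve_left hb0
  · refine ⟨aeval (seqShift ℤ ℤ) A m n, n, ?_⟩
    have h2 : (fun n => (m n : ℝ) + l n) =
      (fun n => (Int.castAddHom ℝ).toIntLinearMap (m n)) + l := rfl
    rw [h2, map_add, Pi.add_apply, aeval_seqShift_comp_linearMap]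
    simp

theorem isPVNumber_and_mem_of_finite {α ξ : ℝ} (hα : IsIntegral ℚ α) (hα1 : 1 < α) (hξ : ξ ≠ 0)
    (hfin : (seqLimitPoints (fun n : ℕ => Int.fract (ξ * α ^ n))).Finite) :
    IsPVNumber α ∧ ξ ∈ ℚ⟮α⟯ := by
  obtain ⟨l, hl, hlim⟩ := exists_tendsto_sub_of_finite_seqLimitPoints
    (isCompact_Icc (a := 0) (b := 1))
    (fun n => ⟨Int.fract_nonneg _, (Int.fract_lt_one (ξ * α ^ n)).le⟩) hfin
  have hlfin : (Set.range l).Finite := hfin.subset (Set.range_subset_iff.mpr hl)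
  have hlim' : Tendsto (fun n => ξ * α ^ n - ((⌊ξ * α ^ n⌋ : ℤ) + l n)) atTop (𝓝 0) := by
    refine hlim.congr fun n => ?_
    rw [Int.fract]
    ring
  obtain ⟨n₀, hn₀⟩ := eventually_atTop.mp (eventually_aeval_seqShift_eq_zero hlfin hlim')
  set m : ℕ → ℤ := fun n => ⌊ξ * α ^ n⌋
  have hrec : aeval (seqShift ℚ ℝ) (minpoly ℚ α) (fun n => (m (n + n₀) : ℝ) + l (n + n₀)) = 0 := by
    funext n
    rw [aeval_seqShift_translate (minpoly ℚ α) (fun n => (m n : ℝ) + l n)]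
    exact hn₀ _ (Nat.le_add_left _ _)
  have hint : ∀ k : ℤ, (k : ℝ) ∈ Submodule.span ℚ {(1 : ℝ)} := fun k =>
    Submodule.mem_span_singleton.mpr ⟨k, by simp [Rat.smul_def]⟩
  -- In `ℝ / ℚ` the integer part `m` disappears, so the recurrence passes to the finite-valued `l`
  -- alone.
  have hmod : (fun n => (Submodule.span ℚ {(1 : ℝ)}).mkQ (l (n + n₀))) = 0 := by
    refine eq_zero_of_finite_range_of_minpoly hα hα1 ?_ ?_
    · have h : (fun n => (Submodule.span ℚ {(1 : ℝ)}).mkQ (l (n + n₀))) =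
          fun n => (Submodule.span ℚ {(1 : ℝ)}).mkQ ((m (n + n₀) : ℝ) + l (n + n₀)) := by
        funext n
        rw [map_add, Submodule.mkQ_apply _ (m (n + n₀) : ℝ),
          (Submodule.Quotient.mk_eq_zero _).mpr (hint _), zero_add]
      funext n
      rw [h, aeval_seqShift_comp_linearMap, hrec]
      simp
    · refine (hlfin.image (Submodule.span ℚ {(1 : ℝ)}).mkQ).subset ?_
      rintro _ ⟨n, rfl⟩
      exact ⟨_, ⟨_, rfl⟩, rfl⟩
  have hrat : ∀ n, ∃ q : ℚ, (q : ℝ) = l (n + n₀) := by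
    intro n
    obtain ⟨q, hq⟩ := Submodule.mem_span_singleton.mp
      ((Submodule.Quotient.mk_eq_zero _).mp (congrFun hmod n))
    exact ⟨q, by simpa [Rat.smul_def] using hq⟩
  choose q hq using hrat
  have hqfin : (Set.range q).Finite := by
    refine Set.Finite.of_finite_image (f := ((↑) : ℚ → ℝ)) (hlfin.subset ?_)
      Rat.cast_injective.injOn
    rintro _ ⟨_, ⟨n, rfl⟩, rfl⟩
    exact ⟨_, (hq n).symm⟩
  have : Finite (Set.range q) := hqfin
  -- The finitely many values of `q` share a common denominator `N`.
  obtain ⟨⟨N, hN⟩, hNq⟩ := IsLocalization.exist_integer_multiples_of_finite (nonZeroDivisors ℤ)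
    (fun r : Set.range q => (r : ℚ))
  have hα0 : α ≠ 0 := by positivity
  have hbdd : ∀ n, ∃ k : ℤ, (N : ℚ) * ((m (n + n₀) : ℚ) + q n) = k := by
    intro n
    obtain ⟨k, hk⟩ := hNq ⟨q n, n, rfl⟩
    refine ⟨N * m (n + n₀) + k, ?_⟩
    simp only [algebraMap_int_eq, eq_intCast, zsmul_eq_mul] at hk
    push_cast
    rw [hk]
    ring
  have hrecQ : aeval (seqShift ℚ ℚ) (minpoly ℚ α) (fun n => (m (n + n₀) : ℚ) + q n) = 0 := by
    funext n
    apply (algebraMap ℚ ℝ).injective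
    have h := aeval_seqShift_comp_linearMap (Algebra.linearMap ℚ ℝ) (minpoly ℚ α)
      (fun n => (m (n + n₀) : ℚ) + q n) n
    rw [Algebra.linearMap_apply] at h
    rw [← h, Pi.zero_apply, map_zero]
    refine Eq.trans ?_ (congrFun hrec n)
    refine congrArg (fun v => aeval (seqShift ℚ ℝ) (minpoly ℚ α) v n) (funext fun k => ?_)
    simp [hq]
  -- Starting at `n₀` replaces `ξ` by `ξ * α ^ n₀`; the factor is divided out within `ℚ(α)` at the
  -- end.
  have hlimQ : Tendsto (fun n => ξ * α ^ n₀ * α ^ n - (((m (n + n₀) : ℚ) + q n : ℚ) : ℝ))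
      atTop (𝓝 0) := by
    refine ((tendsto_add_atTop_iff_nat n₀).mpr hlim').congr fun n => ?_
    change ξ * α ^ (n + n₀) - (m (n + n₀) + l (n + n₀)) = _
    push_cast
    rw [hq, pow_add]
    ring
  obtain ⟨hPV, hmem⟩ := isPVNumber_and_mem_of_rational_approx hα hα1
    (mul_ne_zero hξ (pow_ne_zero _ hα0)) (nonZeroDivisors.ne_zero hN) hbdd hrecQ hlimQ
  refine ⟨hPV, ?_⟩
  have := div_mem hmem (pow_mem (IntermediateField.mem_adjoin_simple_self ℚ α) n₀)
  rwa [mul_div_cancel_right₀ _ (pow_ne_zero _ hα0)] at this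

theorem theorem1 (α ξ : ℝ) (hα : IsAlgebraic ℚ α) (hα1 : 1 < α) (hξ : 0 < ξ) :
    (seqLimitPoints (fun n : ℕ => Int.fract (ξ * α ^ n))).Finite ↔
      IsPVNumber α ∧ ξ ∈ ℚ⟮α⟯ :=
  ⟨isPVNumber_and_mem_of_finite hα.isIntegral hα1 hξ.ne',
    fun h => finite_seqLimitPoints_of_isPVNumber h.1 h.2⟩
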